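/- Let $M,N\ge 0$ be integers with $M+N\ge 1$, and let $X_1,\dots,X_M,Y_1,\dots,Y_N$ be independent normal random variables, $X_i\sim N(0,\sigma_{X_i}^2)$ and $Y_j\sim N(0,\sigma_{Y_j}^2)$, with all $\sigma_{X_i},\sigma_{Y_j}>0$. Put $\sigma_M=\sigma_{X_1}\cdots\sigma_{X_M}$, $s_N=\sigma_{Y_1}\cdots\sigma_{Y_N}$ and $$Z=\frac{X_1\cdots X_M}{Y_1\cdots Y_N},$$ where empty products are equal to $1$. Then $Z$ has a probability density function $f_Z$ that is continuous on $\mathbb{R}\setminus\{0\}$ (and is thereby uniquely determined there), and it satisfies the following. (i) If $M\ge 1$ and $N\ge 0$, then, as $z\to0$ (through $z\neq0$), $$f_Z(z)\sim\frac{2^{(M+N-2)/2}\,s_N}{\pi^{(M+N)/2}\,\sigma_M}\,\frac{(-\ln|z|)^{M-1}}{(M-1)!}.$$ (ii) If $M=0$ and $N\ge1$, then, as $z\to0$ (through $z\neq0$), $$f_Z(z)\sim\frac{2^{(N-2)/2}}{\sqrt{N\pi}\,s_N^{1/N}}\,|z|^{-(N+1)/N}\exp\bigg(-\frac{N}{2(s_N|z|)^{2/N}}\bigg).$$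 Here $a(z)\sim b(z)$ means $a(z)/b(z)\to1$. -/

import Mathlib

open MeasureTheory ProbabilityTheory Filter Topology Asymptotics
open scoped BigOperators Nat

/-- The ratio `(X₁ ⋯ X_M) / (Y₁ ⋯ Y_N)`, an empty product being `1`. -/
noncomputable def productRatio {Ω : Type*} {M N : ℕ} (X : Fin M → Ω → ℝ) (Y : Fin N → Ω → ℝ) :
    Ω → ℝ :=
  fun ω => (∏ i, X i ω) / (∏ j, Y j ω)

/-- `f` is the probability density function, with respect to Lebesgue measure, of the real random
variable `Z`, in the version that is continuous away from the origin. The continuity determines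
`f z` for every `z ≠ 0`; the value `f 0` is left free. -/
structure IsPDFContinuousOffZero {Ω : Type*} [MeasurableSpace Ω] (f : ℝ → ℝ) (Z : Ω → ℝ)
    (P : Measure Ω) : Prop where
  nonneg : ∀ z, 0 ≤ f z
  continuousOn : ContinuousOn f {0}ᶜ
  hasLaw : HasLaw Z (volume.withDensity fun z => ENNReal.ofReal (f z)) P

/-! Rescaling reduces everything to unit variances. Conditioning on an independent factor `w ≠ 0`
with law `μ`, multiplication by a standard normal gives the density `∫ |w|⁻¹ φ(z/w) dμ(w)`, with φ
the normal density. Both asymptotics follow by induction on the number of normal factors, applied to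
this formula in the logarithmic coordinate `y = log |w|`.

Near zero (M ≥ 1), start from the law of `1/∏ Y`. The first normal factor gives a density with the
finite limit `φ(0) E|∏ Y| = φ(0) (2φ(0))^N`. If `f(e^{-L}) ~ a L^k`, then φ cuts the next integral
off at `|w| ≈ |z|`, and `∫₀^L y^k dy` yields `2φ(0) a L^(k+1)/(k+1)`
(`IsEvenDensity.tendsto_productDensity_log`). Iteration produces the power of the logarithm and the
factorial.

For M = 0, Z is the reciprocal of a product of normals, so its density at zero reflects the tail of
that product. Laplace's method gives the tail one factor at a time
(`IsEvenDensity.tendsto_tailRatio_productDensity`); inversion carries it to zero. -/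

/-! ### The standard normal density -/

/-- The density of the standard normal distribution. -/
noncomputable def stdPDF (x : ℝ) : ℝ := (√(2 * Real.pi))⁻¹ * Real.exp (-x ^ 2 / 2)

theorem stdPDF_nonneg (x : ℝ) : 0 ≤ stdPDF x := by unfold stdPDF; positivity

theorem stdPDF_neg (x : ℝ) : stdPDF (-x) = stdPDF x := by simp [stdPDF]

theorem stdPDF_zero : stdPDF 0 = (√(2 * Real.pi))⁻¹ := by simp [stdPDF]

theorem continuous_stdPDF : Continuous stdPDF := by unfold stdPDF; fun_prop

theorem measurable_stdPDF : Measurable stdPDF := continuous_stdPDF.measurable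

theorem inv_sqrt_two_pi_le_one : (√(2 * Real.pi))⁻¹ ≤ 1 := by
  apply inv_le_one_of_one_le₀
  rw [Real.one_le_sqrt]
  linarith [Real.pi_gt_three]

theorem stdPDF_le_stdPDF_zero (x : ℝ) : stdPDF x ≤ stdPDF 0 := by
  rw [stdPDF_zero, stdPDF]
  refine mul_le_of_le_one_right (by positivity) (Real.exp_le_one_iff.2 ?_)
  nlinarith [sq_nonneg x]

theorem stdPDF_le_one (x : ℝ) : stdPDF x ≤ 1 :=
  (stdPDF_le_stdPDF_zero x).trans (stdPDF_zero ▸ inv_sqrt_two_pi_le_one)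

/-- At `x = z / w` this bounds `|w|⁻¹ * stdPDF (z / w)` by `|z|⁻¹` uniformly in `w`, so away from `z
= 0` no moment condition on the other factor is needed. -/
theorem abs_mul_stdPDF_le_one (x : ℝ) : |x| * stdPDF x ≤ 1 := by
  have h1 : |x| * Real.exp (-x ^ 2 / 2) ≤ 1 := by
    have h2 : |x| ≤ Real.exp (x ^ 2 / 2) := by
      have := Real.add_one_le_exp (x ^ 2 / 2)
      nlinarith [sq_nonneg (|x| - 1), sq_abs x]
    have h3 : Real.exp (-x ^ 2 / 2) = (Real.exp (x ^ 2 / 2))⁻¹ := by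
      rw [← Real.exp_neg]; ring_nf
    rw [h3, ← div_eq_mul_inv]
    exact (div_le_one (Real.exp_pos _)).2 h2
  unfold stdPDF
  calc |x| * ((√(2 * Real.pi))⁻¹ * Real.exp (-x ^ 2 / 2))
      = (√(2 * Real.pi))⁻¹ * (|x| * Real.exp (-x ^ 2 / 2)) := by ring
    _ ≤ 1 * 1 := mul_le_mul inv_sqrt_two_pi_le_one h1 (by positivity) zero_le_one
    _ = 1 := one_mul 1

theorem tendsto_stdPDF_atTop : Tendsto stdPDF atTop (𝓝 0) := by
  refine squeeze_zero' (Eventually.of_forall stdPDF_nonneg) ?_ tendsto_inv_atTop_zero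
  filter_upwards [eventually_gt_atTop 0] with x hx
  rw [inv_eq_one_div, le_div_iff₀ hx, mul_comm]
  simpa [abs_of_pos hx] using abs_mul_stdPDF_le_one x

theorem gaussianPDFReal_zero_one (x : ℝ) : gaussianPDFReal 0 1 x = stdPDF x := by
  simp [gaussianPDFReal, stdPDF]

theorem gaussianReal_map_mul_const_apply {w : ℝ} (hw : w ≠ 0) :
    (gaussianReal 0 1).map (· * w) =
      volume.withDensity fun z => ENNReal.ofReal (|w|⁻¹ * stdPDF (z / w)) := by
  rw [gaussianReal_map_mul_const, mul_zero, mul_one, gaussianReal_of_var_ne_zero]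
  · congr 1
    funext z
    rw [gaussianPDF, ← gaussianPDFReal_zero_one, div_eq_inv_mul, gaussianPDFReal_inv_mul hw]
    rw [inv_mul_cancel_left₀ (abs_ne_zero.2 hw)]
    simp
  · rw [Ne, ← NNReal.coe_eq_zero]
    simpa using hw

/-! ### Density of a product with an independent standard normal -/

/-- The density of the product of a standard normal variable and an independent variable with
law `μ`. -/
noncomputable def productDensity (μ : Measure ℝ) (z : ℝ) : ℝ :=
  ∫ w, |w|⁻¹ * stdPDF (z / w) ∂μ

/-- `f` is an even density of `μ`, continuous away from the origin, with `|z| * f z` bounded. -/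
structure IsEvenDensity (f : ℝ → ℝ) (μ : Measure ℝ) : Prop where
  nonneg : ∀ z, 0 ≤ f z
  even : ∀ z, f (-z) = f z
  continuousOn : ContinuousOn f {0}ᶜ
  abs_mul_le : ∃ C, ∀ z, |z| * f z ≤ C
  eq_withDensity : μ = volume.withDensity fun z => ENNReal.ofReal (f z)

theorem productDensity_integrand_nonneg (z w : ℝ) : 0 ≤ |w|⁻¹ * stdPDF (z / w) :=
  mul_nonneg (by positivity) (stdPDF_nonneg _)

theorem productDensity_nonneg (μ : Measure ℝ) (z : ℝ) : 0 ≤ productDensity μ z :=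
  integral_nonneg fun w => productDensity_integrand_nonneg z w

theorem productDensity_neg (μ : Measure ℝ) (z : ℝ) :
    productDensity μ (-z) = productDensity μ z := by
  simp [productDensity, neg_div, stdPDF_neg]

theorem abs_mul_productDensity_integrand_le (z w : ℝ) :
    |z| * (|w|⁻¹ * stdPDF (z / w)) ≤ 1 := by
  have := abs_mul_stdPDF_le_one (z / w)
  rwa [abs_div, div_eq_mul_inv, mul_assoc] at this

theorem productDensity_integrand_le {z : ℝ} (hz : z ≠ 0) (w : ℝ) :
    |w|⁻¹ * stdPDF (z / w) ≤ |z|⁻¹ := by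
  rw [inv_eq_one_div |z|, le_div_iff₀ (abs_pos.2 hz), mul_comm]
  exact abs_mul_productDensity_integrand_le z w

theorem measurable_productDensity_integrand :
    Measurable fun p : ℝ × ℝ => |p.2|⁻¹ * stdPDF (p.1 / p.2) := by
  have := measurable_stdPDF
  fun_prop

theorem measurable_productDensity_integrand_right (z : ℝ) :
    Measurable fun w : ℝ => |w|⁻¹ * stdPDF (z / w) := by
  have := measurable_stdPDF
  fun_prop

theorem integrable_productDensity_integrand (μ : Measure ℝ) [IsFiniteMeasure μ] {z : ℝ}
    (hz : z ≠ 0) : Integrable (fun w => |w|⁻¹ * stdPDF (z / w)) μ := by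
  refine Integrable.of_bound (measurable_productDensity_integrand_right z).aestronglyMeasurable
    |z|⁻¹ (Eventually.of_forall fun w => ?_)
  rw [Real.norm_of_nonneg (productDensity_integrand_nonneg z w)]
  exact productDensity_integrand_le hz w

theorem abs_mul_productDensity_le (μ : Measure ℝ) [IsProbabilityMeasure μ] (z : ℝ) :
    |z| * productDensity μ z ≤ 1 := by
  rw [productDensity, ← integral_const_mul]
  calc ∫ w, |z| * (|w|⁻¹ * stdPDF (z / w)) ∂μ ≤ ∫ _, (1 : ℝ) ∂μ := by
        refine integral_mono_of_nonneg (Eventually.of_forall fun w =>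
          mul_nonneg (abs_nonneg z) (productDensity_integrand_nonneg z w))
          (integrable_const _)
          (Eventually.of_forall fun w => abs_mul_productDensity_integrand_le z w)
    _ = 1 := by simp

theorem continuousOn_productDensity (μ : Measure ℝ) [IsFiniteMeasure μ] :
    ContinuousOn (productDensity μ) {0}ᶜ := by
  intro z₀ hz₀
  have hz₀' : 0 < |z₀| := abs_pos.2 hz₀
  refine ContinuousAt.continuousWithinAt ?_
  refine continuousAt_of_dominated (bound := fun _ => (|z₀| / 2)⁻¹)
    (Eventually.of_forall fun z =>
      (measurable_productDensity_integrand_right z).aestronglyMeasurable) ?_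
    (integrable_const _) (Eventually.of_forall fun w => ?_)
  · have : ∀ᶠ z in 𝓝 z₀, |z₀| / 2 < |z| :=
      continuous_abs.continuousAt.eventually_const_lt (half_lt_self hz₀')
    filter_upwards [this] with z hz
    refine Eventually.of_forall fun w => ?_
    have hz0 : z ≠ 0 := abs_pos.1 ((half_pos hz₀').trans hz)
    rw [Real.norm_of_nonneg (productDensity_integrand_nonneg z w)]
    exact (productDensity_integrand_le hz0 w).trans
      (inv_anti₀ (half_pos hz₀') hz.le)
  · have := continuous_stdPDF
    exact Continuous.continuousAt (by fun_prop)

/-- Given `w ≠ 0`, the product is normal with scale `|w|`; Tonelli then integrates over `w`. An atom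
of `μ` at 0 would survive in the product, hence `h0`. -/
theorem mconv_eq_withDensity_productDensity (μ : Measure ℝ) [IsProbabilityMeasure μ]
    (h0 : μ {0} = 0) :
    gaussianReal 0 1 ∗ₘ μ =
      volume.withDensity fun z => ENNReal.ofReal (productDensity μ z) := by
  have hw0 : ∀ᵐ w ∂μ, w ≠ 0 := by
    rw [ae_iff]; simpa using h0
  ext A hA
  rw [Measure.mconv_comm, withDensity_apply _ hA, ← lintegral_indicator_one hA,
    Measure.lintegral_mconv (measurable_one.indicator hA)]
  calc ∫⁻ w, ∫⁻ x, A.indicator 1 (w * x) ∂(gaussianReal 0 1) ∂μ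
      = ∫⁻ w, ∫⁻ z in A, ENNReal.ofReal (|w|⁻¹ * stdPDF (z / w)) ∂volume ∂μ := by
        refine lintegral_congr_ae (hw0.mono fun w hw => ?_)
        have h1 := lintegral_map (μ := gaussianReal 0 1) (f := A.indicator (1 : ℝ → ENNReal))
          (g := (· * w)) (measurable_one.indicator hA) (measurable_mul_const w)
        simp only [mul_comm w]
        rw [← h1, gaussianReal_map_mul_const_apply hw, lintegral_indicator_one hA,
          withDensity_apply _ hA]
    _ = ∫⁻ z in A, ∫⁻ w, ENNReal.ofReal (|w|⁻¹ * stdPDF (z / w)) ∂μ ∂volume := by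
        apply lintegral_lintegral_swap
        exact (measurable_productDensity_integrand.comp measurable_swap).ennreal_ofReal.aemeasurable
    _ = ∫⁻ z in A, ENNReal.ofReal (productDensity μ z) := by
        refine lintegral_congr_ae (ae_restrict_of_ae ?_)
        filter_upwards [Measure.ae_ne volume (0 : ℝ)] with z hz
        rw [productDensity, ofReal_integral_eq_lintegral_ofReal
          (integrable_productDensity_integrand μ hz)
          (Eventually.of_forall fun w => productDensity_integrand_nonneg z w)]

theorem isEvenDensity_productDensity (μ : Measure ℝ) [IsProbabilityMeasure μ] (h0 : μ {0} = 0) :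
    IsEvenDensity (productDensity μ) (gaussianReal 0 1 ∗ₘ μ) where
  nonneg := productDensity_nonneg μ
  even := productDensity_neg μ
  continuousOn := continuousOn_productDensity μ
  abs_mul_le := ⟨1, abs_mul_productDensity_le μ⟩
  eq_withDensity := mconv_eq_withDensity_productDensity μ h0

theorem measurable_of_continuousOn_compl_zero {f : ℝ → ℝ} (hf : ContinuousOn f {0}ᶜ) :
    Measurable f :=
  measurable_of_continuousOn_compl_singleton 0 hf

theorem IsEvenDensity.measurable {f : ℝ → ℝ} {μ : Measure ℝ} (h : IsEvenDensity f μ) :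
    Measurable f :=
  measurable_of_continuousOn_compl_zero h.continuousOn

theorem IsEvenDensity.measure_singleton {f : ℝ → ℝ} {μ : Measure ℝ} (h : IsEvenDensity f μ)
    (x : ℝ) : μ {x} = 0 := by
  rw [h.eq_withDensity]
  exact withDensity_absolutelyContinuous _ _ (by simp)

theorem IsEvenDensity.apply_abs {f : ℝ → ℝ} {μ : Measure ℝ} (h : IsEvenDensity f μ) (z : ℝ) :
    f |z| = f z := by
  rcases abs_choice z with hz | hz <;> rw [hz]
  exact h.even z

/-! ### Growth of the logarithmic singularity at the origin -/

theorem integral_comp_exp (g : ℝ → ℝ) :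
    ∫ t in Set.Ioi 0, g t = ∫ y, Real.exp y * g (Real.exp y) := by
  have := integral_image_eq_integral_abs_deriv_smul (s := Set.univ) (f := Real.exp)
    (f' := Real.exp) MeasurableSet.univ (fun x _ => (Real.hasDerivAt_exp x).hasDerivWithinAt)
    Real.exp_injective.injOn g
  rw [Set.image_univ, Real.range_exp] at this
  simpa using this

/-- Evenness folds the integral onto the half-line, and under `t = exp y` the Jacobian cancels
`|t|⁻¹`: multiplicative convolution becomes additive. -/
theorem IsEvenDensity.productDensity_eq {f : ℝ → ℝ} {μ : Measure ℝ} (h : IsEvenDensity f μ)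
    (z : ℝ) :
    productDensity μ z = 2 * ∫ y, f (Real.exp y) * stdPDF (z * Real.exp (-y)) := by
  rw [productDensity, h.eq_withDensity, integral_withDensity_eq_integral_toReal_smul
    h.measurable.ennreal_ofReal (Eventually.of_forall fun _ => ENNReal.ofReal_lt_top)]
  have h1 : ∀ t, (ENNReal.ofReal (f t)).toReal • (|t|⁻¹ * stdPDF (z / t)) =
      (fun u => f u * (u⁻¹ * stdPDF (z / u))) |t| := by
    intro t
    rw [ENNReal.toReal_ofReal (h.nonneg t), smul_eq_mul]
    simp only [h.apply_abs]
    rcases abs_choice t with ht | ht <;> rw [ht]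
    rw [div_neg, stdPDF_neg]
  simp_rw [h1]
  rw [_root_.integral_comp_abs (f := fun u => f u * (u⁻¹ * stdPDF (z / u))), integral_comp_exp]
  congr 1
  refine integral_congr_ae (Eventually.of_forall fun y => ?_)
  have := (Real.exp_pos y).ne'
  simp only [Real.exp_neg, div_eq_mul_inv]
  field_simp

theorem integrable_one_add_abs_pow_mul_exp_neg_abs (k : ℕ) :
    Integrable fun v : ℝ => (1 + |v|) ^ k * Real.exp (-|v|) := by
  refine (integrable_inv_one_add_sq.const_mul (Real.exp 1 * (k + 2)!)).mono'
    (Continuous.aestronglyMeasurable (by fun_prop)) (Eventually.of_forall fun v => ?_)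
  rw [Real.norm_of_nonneg (by positivity)]
  have hv := abs_nonneg v
  have h1 := Real.pow_div_factorial_le_exp (1 + |v|) (by positivity) (k + 2)
  rw [div_le_iff₀ (by positivity), Real.exp_add, pow_add] at h1
  have h2 : 1 + v ^ 2 ≤ (1 + |v|) ^ 2 := by nlinarith [sq_abs v]
  rw [Real.exp_neg, ← div_eq_mul_inv, ← div_eq_mul_inv, div_le_div_iff₀ (by positivity)
    (by positivity)]
  calc (1 + |v|) ^ k * (1 + v ^ 2) ≤ (1 + |v|) ^ k * (1 + |v|) ^ 2 := by gcongr
    _ ≤ _ := by linarith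

theorem IsEvenDensity.exists_le_exp {f : ℝ → ℝ} {μ : Measure ℝ} (h : IsEvenDensity f μ) :
    ∃ C, 0 ≤ C ∧ ∀ y, f (Real.exp (-y)) ≤ C * Real.exp y := by
  obtain ⟨C, hC⟩ := h.abs_mul_le
  refine ⟨C, le_trans (by simp) (hC 0), fun y => ?_⟩
  have := hC (Real.exp (-y))
  rw [abs_of_pos (Real.exp_pos _), Real.exp_neg] at this
  rw [Real.exp_neg]
  rwa [inv_mul_le_iff₀ (Real.exp_pos _), mul_comm] at this

/-- The hypothesis controls only large `y`; the bound on `|z| * f z` covers the remaining compact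
range. One constant serves both estimates, which dominate the integrand on either side of `v = 0`.
-/
theorem IsEvenDensity.exists_le_pow {f : ℝ → ℝ} {μ : Measure ℝ} (h : IsEvenDensity f μ)
    {k : ℕ} {a : ℝ} (hf : Tendsto (fun L => f (Real.exp (-L)) / L ^ k) atTop (𝓝 a)) :
    ∃ C, 0 ≤ C ∧ (∀ y, f (Real.exp (-y)) ≤ C * Real.exp y) ∧
      ∀ y, 0 ≤ y → f (Real.exp (-y)) ≤ C * (1 + y) ^ k := by
  obtain ⟨C₀, hC₀, hexp⟩ := h.exists_le_exp
  obtain ⟨Y, hY⟩ := eventually_atTop.1 ((hf.eventually_lt_const (lt_add_one a)).and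
    (eventually_gt_atTop 0))
  have hm : 0 ≤ max (a + 1) 0 := le_max_right _ _
  have hE : 1 ≤ Real.exp |Y| := Real.one_le_exp (abs_nonneg Y)
  refine ⟨max (a + 1) 0 + C₀ * Real.exp |Y|, by positivity, fun y => ?_, fun y hy => ?_⟩
  · refine (hexp y).trans (mul_le_mul_of_nonneg_right ?_ (Real.exp_pos _).le)
    nlinarith
  · have h1 : 1 ≤ (1 + y) ^ k := one_le_pow₀ (by linarith)
    rcases le_total Y y with hYy | hYy
    · obtain ⟨h2, h3⟩ := hY y hYy
      rw [div_lt_iff₀ (by positivity)] at h2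
      have h4 : y ^ k ≤ (1 + y) ^ k := pow_le_pow_left₀ hy (by linarith) k
      calc f (Real.exp (-y)) ≤ (a + 1) * y ^ k := h2.le
        _ ≤ max (a + 1) 0 * (1 + y) ^ k :=
          mul_le_mul (le_max_left _ _) h4 (by positivity) hm
        _ ≤ _ := mul_le_mul_of_nonneg_right (le_add_of_nonneg_right (by positivity))
          (by positivity)
    · calc f (Real.exp (-y)) ≤ C₀ * Real.exp y := hexp y
        _ ≤ C₀ * Real.exp |Y| := by
          gcongr
          exact hYy.trans (le_abs_self Y)
        _ ≤ max (a + 1) 0 + C₀ * Real.exp |Y| := by linarith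
        _ ≤ _ := le_mul_of_one_le_right (by positivity) h1

theorem stdPDF_exp_le {L v : ℝ} (hL : 1 ≤ L) :
    stdPDF (Real.exp (L * (v - 1))) ≤ Real.exp (1 - v) := by
  rcases le_total v 1 with hv | hv
  · exact (stdPDF_le_one _).trans (Real.one_le_exp (by linarith))
  · have := abs_mul_stdPDF_le_one (Real.exp (L * (v - 1)))
    rw [abs_of_pos (Real.exp_pos _), ← le_div_iff₀' (Real.exp_pos _), one_div,
      ← Real.exp_neg] at this
    refine this.trans (Real.exp_le_exp.2 ?_)
    nlinarith

/-- The substitution `y = -L * v` contributes the extra power of `L`. The Gaussian factor becomes a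
soft cutoff, tending to `stdPDF 0` for `v < 1` and to 0 for `v > 1`. -/
theorem IsEvenDensity.productDensity_exp_neg {f : ℝ → ℝ} {μ : Measure ℝ} (h : IsEvenDensity f μ)
    {L : ℝ} (hL : 0 < L) (k : ℕ) :
    productDensity μ (Real.exp (-L)) / L ^ (k + 1) =
      2 * ∫ v, f (Real.exp (-(L * v))) / L ^ k * stdPDF (Real.exp (L * (v - 1))) := by
  have h1 := Measure.integral_comp_mul_left
    (fun y => f (Real.exp y) * stdPDF (Real.exp (-L) * Real.exp (-y))) (-L)
  rw [inv_neg, abs_neg, abs_of_pos (inv_pos.2 hL), smul_eq_mul, eq_inv_mul_iff_mul_eq₀ hL.ne'] at h1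
  rw [h.productDensity_eq, ← h1]
  have h2 : ∀ v, f (Real.exp (-(L * v))) / L ^ k * stdPDF (Real.exp (L * (v - 1))) =
      (L ^ k)⁻¹ * (f (Real.exp (-L * v)) * stdPDF (Real.exp (-L) * Real.exp (-(-L * v)))) := by
    intro v
    rw [← Real.exp_add]
    ring_nf
  simp_rw [h2]
  rw [integral_const_mul]
  field_simp
  ring

/-- Multiplication by an independent standard normal variable raises the order of the logarithmic
singularity of an even density at the origin by one. -/
theorem IsEvenDensity.tendsto_productDensity_log {f : ℝ → ℝ} {μ : Measure ℝ}
    (h : IsEvenDensity f μ) {k : ℕ} {a : ℝ}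
    (hf : Tendsto (fun L => f (Real.exp (-L)) / L ^ k) atTop (𝓝 a)) :
    Tendsto (fun L => productDensity μ (Real.exp (-L)) / L ^ (k + 1)) atTop
      (𝓝 (2 * stdPDF 0 * a / (k + 1))) := by
  obtain ⟨C, hC, hexp, hpow⟩ := h.exists_le_pow hf
  have hlim : 2 * stdPDF 0 * a / (k + 1) =
      2 * ∫ v, (Set.Ioo (0 : ℝ) 1).indicator (fun v => v ^ k * (a * stdPDF 0)) v := by
    rw [integral_indicator measurableSet_Ioo, ← integral_Ioc_eq_integral_Ioo,
      ← intervalIntegral.integral_of_le zero_le_one, intervalIntegral.integral_mul_const,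
      integral_pow]
    simp
    ring
  rw [hlim]
  have heq : (fun L => 2 * ∫ v, f (Real.exp (-(L * v))) / L ^ k *
      stdPDF (Real.exp (L * (v - 1)))) =ᶠ[atTop]
      fun L => productDensity μ (Real.exp (-L)) / L ^ (k + 1) := by
    filter_upwards [eventually_gt_atTop 0] with L hL
    exact (h.productDensity_exp_neg hL k).symm
  refine Tendsto.congr' heq (Tendsto.const_mul 2 ?_)
  refine tendsto_integral_filter_of_dominated_convergence
    (fun v => C * Real.exp 1 * ((1 + |v|) ^ k * Real.exp (-|v|))) ?_ ?_
    ((integrable_one_add_abs_pow_mul_exp_neg_abs k).const_mul _) ?_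
  · refine Eventually.of_forall fun L => Measurable.aestronglyMeasurable ?_
    have h1 := h.measurable
    have h2 := measurable_stdPDF
    fun_prop
  · filter_upwards [eventually_ge_atTop 1] with L hL
    refine Eventually.of_forall fun v => ?_
    have hL0 : 0 < L := by linarith
    have hLk : 1 ≤ L ^ k := one_le_pow₀ hL
    rw [Real.norm_of_nonneg (mul_nonneg (div_nonneg (h.nonneg _) (by positivity))
      (stdPDF_nonneg _))]
    rcases le_total 0 v with hv | hv
    · have h1 : f (Real.exp (-(L * v))) / L ^ k ≤ C * (1 + v) ^ k := by
        rw [div_le_iff₀ (by positivity), mul_assoc, ← mul_pow]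
        refine (hpow _ (by positivity)).trans ?_
        gcongr
        nlinarith
      calc _ ≤ C * (1 + v) ^ k * Real.exp (1 - v) :=
            mul_le_mul h1 (stdPDF_exp_le hL) (stdPDF_nonneg _) (by positivity)
        _ = _ := by
          rw [abs_of_nonneg hv, sub_eq_add_neg, Real.exp_add]; ring
    · have h1 : f (Real.exp (-(L * v))) / L ^ k ≤ C * Real.exp v := by
        refine (div_le_self (h.nonneg _) hLk).trans ((hexp _).trans ?_)
        gcongr
        nlinarith
      have h2 : 1 ≤ (1 + |v|) ^ k := one_le_pow₀ (by linarith [abs_nonneg v])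
      have h3 : 1 ≤ Real.exp 1 := Real.one_le_exp zero_le_one
      calc _ ≤ C * Real.exp v * 1 :=
            mul_le_mul h1 (stdPDF_le_one _) (stdPDF_nonneg _) (by positivity)
        _ ≤ C * Real.exp v * (Real.exp 1 * (1 + |v|) ^ k) := by
          gcongr
          exact one_le_mul_of_one_le_of_one_le h3 h2
        _ = _ := by
          rw [abs_of_nonpos hv, neg_neg]; ring
  -- Pointwise limit: for `v < 0` the bound `C * exp (L * v)` kills the integrand, on `(0, 1)` the
  -- hypothesis gives `v ^ k * a`, and for `v > 1` the Gaussian factor vanishes.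
  · filter_upwards [Measure.ae_ne volume (0 : ℝ), Measure.ae_ne volume (1 : ℝ)] with v hv0 hv1
    rcases lt_or_gt_of_ne hv0 with hv | hv
    · rw [Set.indicator_of_notMem (by simp [hv.le])]
      have h1 : Tendsto (fun L : ℝ => C * Real.exp (L * v)) atTop (𝓝 0) := by
        have : Tendsto (fun L : ℝ => L * v) atTop atBot := tendsto_id.atTop_mul_const_of_neg hv
        simpa using (Real.tendsto_exp_atBot.comp this).const_mul C
      have h2 : ∀ᶠ L : ℝ in atTop, 0 ≤ f (Real.exp (-(L * v))) / L ^ k *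
          stdPDF (Real.exp (L * (v - 1))) := by
        filter_upwards [eventually_ge_atTop 0] with L hL
        exact mul_nonneg (div_nonneg (h.nonneg _) (by positivity)) (stdPDF_nonneg _)
      refine squeeze_zero' h2 ?_ h1
      filter_upwards [eventually_ge_atTop 1] with L hL
      have hL0 : 0 ≤ L := by linarith
      refine (mul_le_of_le_one_right (div_nonneg (h.nonneg _) (by positivity))
        (stdPDF_le_one _)).trans ?_
      exact (div_le_self (h.nonneg _) (one_le_pow₀ hL)).trans (hexp _)
    · have hratio : Tendsto (fun L => f (Real.exp (-(L * v))) / L ^ k) atTop (𝓝 (v ^ k * a)) := by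
        have h1 : Tendsto (fun L : ℝ => L * v) atTop atTop := tendsto_id.atTop_mul_const hv
        refine Tendsto.congr' ?_ ((hf.comp h1).const_mul (v ^ k))
        filter_upwards [eventually_gt_atTop 0] with L hL
        simp only [Function.comp]
        rw [mul_pow]
        field_simp
      rcases lt_or_gt_of_ne hv1 with hv' | hv'
      · rw [Set.indicator_of_mem (show v ∈ Set.Ioo 0 1 from ⟨hv, hv'⟩), ← mul_assoc]
        refine hratio.mul ((continuous_stdPDF.tendsto 0).comp (Real.tendsto_exp_atBot.comp ?_))
        exact tendsto_id.atTop_mul_const_of_neg (by linarith)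
      · rw [Set.indicator_of_notMem (by simp [hv'.le])]
        have := hratio.mul (tendsto_stdPDF_atTop.comp (Real.tendsto_exp_atTop.comp
          (tendsto_id.atTop_mul_const (sub_pos.2 hv'))))
        simpa using this

theorem tendsto_productDensity_zero (μ : Measure ℝ) (hμ : Integrable (fun w => |w|⁻¹) μ) :
    Tendsto (productDensity μ) (𝓝 0) (𝓝 (stdPDF 0 * ∫ w, |w|⁻¹ ∂μ)) := by
  rw [← integral_const_mul]
  refine tendsto_integral_filter_of_dominated_convergence (fun w => |w|⁻¹)
    (Eventually.of_forall fun z =>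
      (measurable_productDensity_integrand_right z).aestronglyMeasurable)
    (Eventually.of_forall fun z => Eventually.of_forall fun w => ?_) hμ
    (Eventually.of_forall fun w => ?_)
  · rw [Real.norm_of_nonneg (productDensity_integrand_nonneg z w)]
    exact mul_le_of_le_one_right (by positivity) (stdPDF_le_one _)
  · have hc : Continuous fun z => |w|⁻¹ * stdPDF (z / w) := by
      have := continuous_stdPDF
      fun_prop
    simpa [mul_comm] using hc.tendsto 0

/-! ### Laplace's method for the tail of a product -/

theorem tendsto_sq_mul_exp_sub (x : ℝ) :
    Tendsto (fun r : ℝ => r ^ 2 * (Real.exp (x / r) - 1 - x / r)) atTop (𝓝 (x ^ 2 / 2)) := by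
  rw [tendsto_iff_dist_tendsto_zero]
  have h0 : Tendsto (fun r : ℝ => |x| ^ 3 / r) atTop (𝓝 0) :=
    tendsto_const_nhds.div_atTop tendsto_id
  refine squeeze_zero' (Eventually.of_forall fun r => dist_nonneg) ?_ h0
  filter_upwards [eventually_ge_atTop |x|, eventually_gt_atTop 0] with r hr hr0
  have h1 : |x / r| ≤ 1 := by
    rw [abs_div, abs_of_pos hr0]
    exact (div_le_one hr0).2 hr
  have h2 := Real.exp_bound h1 (n := 3) (by norm_num)
  simp only [Finset.sum_range_succ, Finset.sum_range_zero] at h2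
  norm_num [Nat.factorial] at h2
  have h3 : r ^ 2 * (Real.exp (x / r) - 1 - x / r) - x ^ 2 / 2 =
      r ^ 2 * (Real.exp (x / r) - (1 + x / r + (x / r) ^ 2 / 2)) := by
    field_simp
    ring
  rw [Real.dist_eq, h3, abs_mul, abs_of_pos (by positivity : 0 < r ^ 2)]
  calc r ^ 2 * |Real.exp (x / r) - (1 + x / r + (x / r) ^ 2 / 2)|
      ≤ r ^ 2 * |x / r| ^ 3 := by
        gcongr
        refine h2.trans (mul_le_of_le_one_right (by positivity) (by norm_num))
    _ = |x| ^ 3 / r := by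
        rw [abs_div, abs_of_pos hr0]
        field_simp

/-- The phase function `(n + 1) * exp (2 * u) + exp (-2 * (n + 1) * u) - (n + 2)`, whose
minimum is `0` at `u = 0`. -/
noncomputable def laplacePhase (n : ℕ) (u : ℝ) : ℝ :=
  (n + 1) * Real.exp (2 * u) + Real.exp (-(2 * (n + 1) * u)) - (n + 2)

/-- Bernoulli's inequality for the power `n + 1` of `exp (-2u)` bounds the phase below by `4 (n + 1)
sinh² u`, and `|sinh u| ≥ |u|`. -/
theorem le_laplacePhase (n : ℕ) (u : ℝ) : 4 * (n + 1) * u ^ 2 ≤ laplacePhase n u := by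
  have h1 : 1 + ((n + 1 : ℕ) : ℝ) * (Real.exp (-(2 * u)) - 1) ≤
      (1 + (Real.exp (-(2 * u)) - 1)) ^ (n + 1) :=
    one_add_mul_le_pow (by linarith [Real.exp_pos (-(2 * u))]) _
  have h2 : (1 + (Real.exp (-(2 * u)) - 1)) ^ (n + 1) = Real.exp (-(2 * (n + 1) * u)) := by
    rw [add_sub_cancel, ← Real.exp_nat_mul]
    push_cast
    ring_nf
  have h3 : 4 * u ^ 2 ≤ Real.exp (2 * u) + Real.exp (-(2 * u)) - 2 := by
    have h5 : u ^ 2 ≤ Real.sinh u ^ 2 := by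
      rcases le_total 0 u with hu | hu
      · nlinarith [Real.self_le_sinh_iff.2 hu]
      · nlinarith [Real.sinh_le_self_iff.2 hu]
    have h6 := Real.cosh_two_mul u
    rw [Real.cosh_sq, Real.cosh_eq] at h6
    linarith
  have h4 : (0 : ℝ) ≤ n + 1 := by positivity
  rw [h2] at h1
  push_cast at h1
  unfold laplacePhase
  nlinarith [mul_le_mul_of_nonneg_left h3 h4]

/-- Constant and linear Taylor terms cancel; the quadratic ones add up to `(n + 1) + (n + 1)²`. -/
theorem tendsto_laplacePhase (n : ℕ) (w : ℝ) :
    Tendsto (fun r : ℝ => r ^ 2 / 2 * laplacePhase n (w / r)) atTop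
      (𝓝 ((n + 1) * (n + 2) * w ^ 2)) := by
  have h := ((tendsto_sq_mul_exp_sub (2 * w)).const_mul (((n : ℝ) + 1) / 2)).add
    ((tendsto_sq_mul_exp_sub (-(2 * (n + 1) * w))).const_mul (1 / 2))
  convert! h using 2 with r
  · unfold laplacePhase
    have e1 : 2 * w / r = 2 * (w / r) := by ring
    have e2 : -(2 * (n + 1) * w) / r = -(2 * (n + 1) * (w / r)) := by ring
    rw [e1, e2]
    ring
  · ring

/-- The quotient of `f (y ^ (n + 1))` by `y ^ (-n) * exp (-(n + 1) * y ^ 2 / 2)`. -/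
noncomputable def tailRatio (f : ℝ → ℝ) (n : ℕ) (y : ℝ) : ℝ :=
  f (y ^ (n + 1)) * y ^ n * Real.exp ((n + 1) * y ^ 2 / 2)

/-- The limit controls large `y`; for small `y` the bound on `|z| * f z` gives `f (y ^ (n + 1)) * y
^ n ≤ C₀ / y`. -/
theorem IsEvenDensity.exists_tailRatio_le {f : ℝ → ℝ} {μ : Measure ℝ} (h : IsEvenDensity f μ)
    {n : ℕ} {c : ℝ} (hf : Tendsto (tailRatio f n) atTop (𝓝 c)) :
    ∃ C, 0 ≤ C ∧ ∀ y, 0 < y → tailRatio f n y ≤ C * (1 + y⁻¹) := by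
  obtain ⟨C₀, hC₀⟩ := h.abs_mul_le
  have hC₀' : 0 ≤ C₀ := le_trans (by simp) (hC₀ 0)
  obtain ⟨Y, hY⟩ := eventually_atTop.1 (hf.eventually_lt_const (lt_add_one c))
  set E := Real.exp ((n + 1) * Y ^ 2 / 2) with hE
  have hE0 : 0 < E := Real.exp_pos _
  have hm : 0 ≤ max (c + 1) 0 := le_max_right _ _
  refine ⟨max (c + 1) 0 + C₀ * E, by positivity, fun y hy => ?_⟩
  rcases le_total Y y with hYy | hYy
  · calc tailRatio f n y ≤ max (c + 1) 0 := (hY y hYy).le.trans (le_max_left _ _)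
      _ ≤ max (c + 1) 0 + C₀ * E := le_add_of_nonneg_right (by positivity)
      _ ≤ _ := le_mul_of_one_le_right (by positivity) (by simp [hy.le])
  · have h1 := hC₀ (y ^ (n + 1))
    rw [abs_of_pos (by positivity), pow_succ] at h1
    have h2 : f (y ^ (n + 1)) * y ^ n ≤ C₀ * y⁻¹ := by
      rw [← div_eq_mul_inv, le_div_iff₀ hy, pow_succ]
      linarith
    calc tailRatio f n y ≤ C₀ * y⁻¹ * E := by
          unfold tailRatio
          refine mul_le_mul h2 ?_ (Real.exp_pos _).le (by positivity)
          rw [hE, Real.exp_le_exp]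
          gcongr
      _ = C₀ * E * y⁻¹ := by ring
      _ ≤ (max (c + 1) 0 + C₀ * E) * (1 + y⁻¹) := by
          refine mul_le_mul (le_add_of_nonneg_left hm) ?_ (by positivity) (by positivity)
          linarith

/-- At `z = r ^ (n + 2)`, writing the other factor as `t ^ (n + 1)`, the exponent to minimise is `(n
+ 1) t² / 2 + (r ^ (n + 2) / t ^ (n + 1))² / 2`. Its minimum `(n + 2) r² / 2` is at `t = r`, and `t
= r * exp u` turns the excess into `r² / 2` times the phase. -/
theorem IsEvenDensity.tailRatio_productDensity {f : ℝ → ℝ} {μ : Measure ℝ}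
    (h : IsEvenDensity f μ) (n : ℕ) {r : ℝ} (hr : 0 < r) :
    tailRatio (productDensity μ) (n + 1) r =
      2 * (n + 1) * (√(2 * Real.pi))⁻¹ * ∫ w, tailRatio f n (r * Real.exp (w / r)) *
        Real.exp (-(n * (w / r))) * Real.exp (-(r ^ 2 / 2 * laplacePhase n (w / r))) := by
  set g : ℝ → ℝ := fun y => f (Real.exp y) * stdPDF (r ^ (n + 2) * Real.exp (-y)) with hg
  -- Centred at `(n + 1) * log r`, this scale gives `t = r * exp (w / r)`, so the peak has width of
  -- order 1 in `w`.
  set b : ℝ := (n + 1) / r with hb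
  have hb0 : 0 < b := by positivity
  have hsub : ∫ y, g y = b * ∫ w, g ((n + 1) * Real.log r + b * w) := by
    have h1 := Measure.integral_comp_mul_left (fun y => g ((n + 1) * Real.log r + y)) b
    rw [integral_add_left_eq_self g, abs_of_pos (inv_pos.2 hb0), smul_eq_mul] at h1
    rw [h1, mul_inv_cancel_left₀ hb0.ne']
  have hpt : ∀ w, g ((n + 1) * Real.log r + b * w) =
      (√(2 * Real.pi))⁻¹ * (r ^ n)⁻¹ * Real.exp (-((n + 2) * r ^ 2 / 2)) *
      (tailRatio f n (r * Real.exp (w / r)) *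
        Real.exp (-(n * (w / r))) * Real.exp (-(r ^ 2 / 2 * laplacePhase n (w / r)))) := by
    intro w
    set u := w / r with hu
    have e1 : Real.exp ((n + 1) * Real.log r + b * w) = (r * Real.exp u) ^ (n + 1) := by
      rw [mul_pow, ← Real.exp_nat_mul, Real.exp_add]
      congr 1
      · rw [← Real.exp_log (pow_pos hr (n + 1)), Real.log_pow]
        push_cast
        rfl
      · congr 1
        rw [hb, hu]
        push_cast
        ring
    have e2 : r ^ (n + 2) * Real.exp (-((n + 1) * Real.log r + b * w)) =
        r * Real.exp (-((n + 1) * u)) := by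
      rw [Real.exp_neg, e1, mul_pow, ← Real.exp_nat_mul, Real.exp_neg]
      push_cast
      field_simp
      ring
    have e3 : (r * Real.exp u) ^ n * Real.exp (-(n * u)) = r ^ n := by
      rw [mul_pow, ← Real.exp_nat_mul, Real.exp_neg]
      field_simp
    simp only [hg]
    rw [e1, e2, tailRatio, stdPDF]
    have e4 : Real.exp (-(r * Real.exp (-((n + 1) * u))) ^ 2 / 2) =
        Real.exp (-((n + 2) * r ^ 2 / 2)) * Real.exp ((n + 1) * (r * Real.exp u) ^ 2 / 2) *
          Real.exp (-(r ^ 2 / 2 * laplacePhase n u)) := by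
      rw [← Real.exp_add, ← Real.exp_add]
      congr 1
      unfold laplacePhase
      rw [mul_pow, mul_pow, ← Real.exp_nat_mul, ← Real.exp_nat_mul]
      push_cast
      ring_nf
    rw [e4]
    calc _ = f ((r * Real.exp u) ^ (n + 1)) * (√(2 * Real.pi))⁻¹ *
          Real.exp (-((n + 2) * r ^ 2 / 2)) * Real.exp ((n + 1) * (r * Real.exp u) ^ 2 / 2) *
          Real.exp (-(r ^ 2 / 2 * laplacePhase n u)) * ((r ^ n)⁻¹ * r ^ n) := by
            rw [inv_mul_cancel₀ (by positivity)]; ring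
      _ = _ := by
            nth_rewrite 2 [← e3]
            ring
  rw [tailRatio, h.productDensity_eq]
  change 2 * (∫ y, g y) * r ^ (n + 1) * _ = _
  rw [hsub]
  simp_rw [hpt]
  rw [integral_const_mul, Real.exp_neg]
  have e5 : (((n + 1 : ℕ) : ℝ) + 1) * r ^ 2 / 2 = (n + 2) * r ^ 2 / 2 := by push_cast; ring
  rw [e5, hb]
  have := (Real.exp_pos ((n + 2) * r ^ 2 / 2)).ne'
  field_simp
  ring

/-- The Laplace method for the density of a product with an independent standard normal variable. -/
theorem IsEvenDensity.tendsto_tailRatio_productDensity {f : ℝ → ℝ} {μ : Measure ℝ}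
    (h : IsEvenDensity f μ) {n : ℕ} {c : ℝ} (hf : Tendsto (tailRatio f n) atTop (𝓝 c)) :
    Tendsto (tailRatio (productDensity μ) (n + 1)) atTop
      (𝓝 (√2 * c * √((n + 1) / (n + 2)))) := by
  obtain ⟨C, hC, hbound⟩ := h.exists_tailRatio_le hf
  have hlim : √2 * c * √((n + 1) / (n + 2)) = 2 * (n + 1) * (√(2 * Real.pi))⁻¹ *
      ∫ w, c * 1 * Real.exp (-((n + 1) * (n + 2)) * w ^ 2) := by
    rw [integral_const_mul, integral_gaussian, Real.sqrt_div (by positivity),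
      Real.sqrt_div (by positivity), Real.sqrt_mul (by positivity), Real.sqrt_mul (by positivity)]
    have h1 : (0 : ℝ) < n + 1 := by positivity
    have h2 : √((n : ℝ) + 1) ^ 2 = n + 1 := Real.sq_sqrt h1.le
    have h3 : √(2 : ℝ) ^ 2 = 2 := Real.sq_sqrt (by norm_num)
    have h4 : √Real.pi ≠ 0 := (Real.sqrt_pos.2 Real.pi_pos).ne'
    field_simp
    rw [h2, h3]
    ring
  rw [hlim]
  refine Tendsto.congr' (f₁ := fun r => 2 * (n + 1) * (√(2 * Real.pi))⁻¹ *
    ∫ w, tailRatio f n (r * Real.exp (w / r)) * Real.exp (-(n * (w / r))) *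
      Real.exp (-(r ^ 2 / 2 * laplacePhase n (w / r)))) ?_ (Tendsto.const_mul _ ?_)
  · filter_upwards [eventually_gt_atTop 0] with r hr
    exact (h.tailRatio_productDensity n hr).symm
  refine tendsto_integral_filter_of_dominated_convergence
    (fun w => 2 * C * Real.exp (n + 1) * Real.exp (-(n + 1) * w ^ 2)) ?_ ?_
    ((integrable_exp_neg_mul_sq (by positivity)).const_mul _) ?_
  · refine Eventually.of_forall fun r => Measurable.aestronglyMeasurable ?_
    have h1 := h.measurable
    unfold tailRatio laplacePhase
    fun_prop
  · filter_upwards [eventually_ge_atTop 1] with r hr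
    refine Eventually.of_forall fun w => ?_
    have hr0 : 0 < r := by linarith
    have hpos : 0 ≤ tailRatio f n (r * Real.exp (w / r)) := by
      unfold tailRatio
      exact mul_nonneg (mul_nonneg (h.nonneg _) (by positivity)) (Real.exp_pos _).le
    rw [Real.norm_of_nonneg (by positivity)]
    set u := w / r with hu
    have huw : |u| ≤ |w| := by
      rw [hu, abs_div, abs_of_pos hr0]
      exact div_le_self (abs_nonneg w) hr
    have hn : (0 : ℝ) ≤ n := by positivity
    have hu1 := neg_abs_le u
    -- Half of the decay `exp (-2 (n + 1) w²)` pays for the growth `exp ((n + 1) |w|)`, leaving an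
    -- integrable Gaussian independent of `r`.
    have hw2 : |w| ≤ w ^ 2 + 1 := by nlinarith [sq_nonneg (|w| - 1), sq_abs w]
    have h1 : tailRatio f n (r * Real.exp u) * Real.exp (-(n * u)) ≤
        2 * C * Real.exp ((n + 1) * |w|) := by
      have h2 : (r * Real.exp u)⁻¹ ≤ Real.exp (-u) := by
        rw [mul_inv, Real.exp_neg]
        exact mul_le_of_le_one_left (by positivity) (inv_le_one_of_one_le₀ hr)
      have h3 : Real.exp (-(n * u)) ≤ Real.exp ((n + 1) * |w|) := by
        apply Real.exp_le_exp.2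
        nlinarith [abs_nonneg w]
      have h4 : Real.exp (-u) * Real.exp (-(n * u)) ≤ Real.exp ((n + 1) * |w|) := by
        rw [← Real.exp_add]
        apply Real.exp_le_exp.2
        nlinarith [abs_nonneg w]
      calc _ ≤ C * (1 + Real.exp (-u)) * Real.exp (-(n * u)) := by
            gcongr
            refine (hbound _ (by positivity)).trans ?_
            gcongr
        _ = C * (Real.exp (-(n * u)) + Real.exp (-u) * Real.exp (-(n * u))) := by ring
        _ ≤ C * (Real.exp ((n + 1) * |w|) + Real.exp ((n + 1) * |w|)) := by gcongr
        _ = _ := by ring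
    have h5 : 2 * (n + 1) * w ^ 2 ≤ r ^ 2 / 2 * laplacePhase n u := by
      have := mul_le_mul_of_nonneg_left (le_laplacePhase n u) (by positivity : 0 ≤ r ^ 2 / 2)
      refine le_trans (le_of_eq ?_) this
      rw [hu]
      field_simp
      ring
    calc _ ≤ 2 * C * Real.exp ((n + 1) * |w|) * Real.exp (-(2 * (n + 1) * w ^ 2)) :=
          mul_le_mul h1 (Real.exp_le_exp.2 (neg_le_neg h5)) (Real.exp_pos _).le (by positivity)
      _ = 2 * C * Real.exp ((n + 1) * |w| + -(2 * (n + 1) * w ^ 2)) := by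
          rw [Real.exp_add]; ring
      _ ≤ 2 * C * Real.exp ((n + 1) + -(n + 1) * w ^ 2) := by
          gcongr 2 * C * Real.exp ?_
          nlinarith
      _ = _ := by rw [Real.exp_add]; ring
  · refine Eventually.of_forall fun w => ?_
    have hw : Tendsto (fun r : ℝ => w / r) atTop (𝓝 0) := tendsto_const_nhds.div_atTop tendsto_id
    have h1 : Tendsto (fun r : ℝ => r * Real.exp (w / r)) atTop atTop := by
      refine tendsto_id.atTop_mul_pos zero_lt_one ?_
      simpa [Function.comp_def] using (Real.continuous_exp.tendsto 0).comp hw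
    have h2 : Tendsto (fun r : ℝ => Real.exp (-(n * (w / r)))) atTop (𝓝 1) := by
      simpa [Function.comp_def] using
        (Real.continuous_exp.tendsto _).comp (hw.const_mul (n : ℝ)).neg
    have h3 : Tendsto (fun r : ℝ => Real.exp (-(r ^ 2 / 2 * laplacePhase n (w / r)))) atTop
        (𝓝 (Real.exp (-((n + 1) * (n + 2)) * w ^ 2))) := by
      have := (Real.continuous_exp.tendsto _).comp (tendsto_laplacePhase n w).neg
      simpa only [neg_mul, Function.comp_def] using this
    exact ((hf.comp h1).mul h2).mul h3

/-! ### Iterating over the normal factors -/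

/-- The law of the product of `n` independent standard normal variables and an independent variable
with law `μ`. -/
noncomputable def gaussianProduct (μ : Measure ℝ) : ℕ → Measure ℝ
  | 0 => μ
  | n + 1 => gaussianReal 0 1 ∗ₘ gaussianProduct μ n

instance isProbabilityMeasure_gaussianProduct (μ : Measure ℝ) [IsProbabilityMeasure μ] (n : ℕ) :
    IsProbabilityMeasure (gaussianProduct μ n) := by
  induction n with
  | zero => assumption
  | succ n ih => rw [gaussianProduct]; infer_instance

theorem gaussianProduct_singleton_zero {μ : Measure ℝ} [IsProbabilityMeasure μ] (h0 : μ {0} = 0)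
    (n : ℕ) : gaussianProduct μ n {0} = 0 := by
  induction n with
  | zero => exact h0
  | succ n ih => exact (isEvenDensity_productDensity _ ih).measure_singleton 0

theorem isEvenDensity_gaussianProduct {μ : Measure ℝ} [IsProbabilityMeasure μ] (h0 : μ {0} = 0)
    (n : ℕ) :
    IsEvenDensity (productDensity (gaussianProduct μ n)) (gaussianProduct μ (n + 1)) :=
  isEvenDensity_productDensity _ (gaussianProduct_singleton_zero h0 n)

theorem gaussianProduct_dirac_one_mconv (μ : Measure ℝ) [IsProbabilityMeasure μ] (n : ℕ) :
    gaussianProduct (Measure.dirac 1) n ∗ₘ μ = gaussianProduct μ n := by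
  induction n with
  | zero => exact Measure.dirac_one_mconv μ
  | succ n ih => rw [gaussianProduct, gaussianProduct, Measure.mconv_assoc, ih]

theorem dirac_one_singleton_zero : Measure.dirac (1 : ℝ) {0} = 0 := by simp

/-- `productDensity` supplies one more normal factor, so `n + 1` factors give the power `n`. Each
inductive step contributes `2 * stdPDF 0 / (k + 1)`, whence the factorial. -/
theorem tendsto_productDensity_gaussianProduct_log {μ : Measure ℝ} [IsProbabilityMeasure μ]
    (h0 : μ {0} = 0) (hμ : Integrable (fun w => |w|⁻¹) μ) (n : ℕ) :
    Tendsto (fun L => productDensity (gaussianProduct μ n) (Real.exp (-L)) / L ^ n) atTop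
      (𝓝 (stdPDF 0 * (∫ w, |w|⁻¹ ∂μ) * (2 * stdPDF 0) ^ n / n !)) := by
  induction n with
  | zero =>
    have h1 : Tendsto (fun L : ℝ => Real.exp (-L)) atTop (𝓝 0) :=
      Real.tendsto_exp_neg_atTop_nhds_zero
    simpa [gaussianProduct, Function.comp_def] using (tendsto_productDensity_zero μ hμ).comp h1
  | succ n ih =>
    have := (isEvenDensity_gaussianProduct h0 n).tendsto_productDensity_log ih
    convert! this using 2
    rw [Nat.factorial_succ]
    push_cast
    field_simp
    ring

theorem productDensity_dirac_one : productDensity (Measure.dirac 1) = stdPDF := by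
  funext z
  simp [productDensity]

/-- This concerns `n + 1` normal factors; the square roots `√((k + 1) / (k + 2))` from the Laplace
steps telescope. -/
theorem tendsto_tailRatio_gaussianProduct (n : ℕ) :
    Tendsto (tailRatio (productDensity (gaussianProduct (Measure.dirac 1) n)) n) atTop
      (𝓝 (√2 ^ n * (√(2 * Real.pi))⁻¹ / √(n + 1))) := by
  induction n with
  | zero =>
    rw [gaussianProduct, productDensity_dirac_one]
    refine tendsto_const_nhds.congr fun r => ?_
    simp only [tailRatio, stdPDF]
    rw [pow_zero, pow_zero, zero_add, mul_one, mul_assoc, ← Real.exp_add]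
    norm_num
    rw [show -r ^ 2 / 2 + r ^ 2 / 2 = 0 by ring, Real.exp_zero, mul_one]
  | succ n ih =>
    have := (isEvenDensity_gaussianProduct dirac_one_singleton_zero
      n).tendsto_tailRatio_productDensity ih
    convert! this using 2
    rw [Real.sqrt_div (by positivity)]
    push_cast
    rw [show (n : ℝ) + 1 + 1 = n + 2 by ring]
    have : √((n : ℝ) + 1) ≠ 0 := by positivity
    field_simp
    ring

theorem integral_abs_gaussianReal :
    Integrable (fun x => |x|) (gaussianReal 0 1) ∧
      ∫ x, |x| ∂(gaussianReal 0 1) = 2 * stdPDF 0 := by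
  constructor
  · have := (memLp_id_gaussianReal (μ := 0) (v := 1) 1).integrable (by simp)
    exact this.abs
  · have h1 : ∫ x in Set.Ioi (0 : ℝ), x * stdPDF x = 0 - -stdPDF 0 := by
      refine integral_Ioi_of_hasDerivAt_of_nonneg' (g := fun x => -stdPDF x) (fun x _ => ?_)
        (fun x hx => mul_nonneg (le_of_lt hx) (stdPDF_nonneg x)) ?_
      · have h2 : HasDerivAt (fun x : ℝ => -x ^ 2 / 2) (-x) x := by
          have := ((hasDerivAt_pow 2 x).neg).div_const 2
          convert! this using 1
          simp
          ring
        have h3 := (h2.exp.const_mul (√(2 * Real.pi))⁻¹).neg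
        unfold stdPDF
        convert! h3 using 1
        ring
      · simpa using tendsto_stdPDF_atTop.neg
    rw [integral_gaussianReal_eq_integral_smul one_ne_zero]
    have h4 : ∀ x : ℝ, gaussianPDFReal 0 1 x • |x| = (fun y => y * stdPDF y) |x| := by
      intro x
      rw [gaussianPDFReal_zero_one, smul_eq_mul, mul_comm]
      rcases abs_choice x with hx | hx <;> simp only [hx, stdPDF_neg]
    simp_rw [h4]
    rw [_root_.integral_comp_abs (f := fun y => y * stdPDF y), h1]
    ring

theorem integral_abs_gaussianProduct (n : ℕ) :
    Integrable (fun x => |x|) (gaussianProduct (Measure.dirac 1) n) ∧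
      ∫ x, |x| ∂(gaussianProduct (Measure.dirac 1) n) = (2 * stdPDF 0) ^ n := by
  induction n with
  | zero =>
    rw [gaussianProduct]
    exact ⟨integrable_dirac (by simp), by simp⟩
  | succ n ih =>
    have hm : Measurable fun p : ℝ × ℝ => p.1 * p.2 := by fun_prop
    have ha : AEStronglyMeasurable (fun x : ℝ => |x|) (Measure.map (fun p : ℝ × ℝ => p.1 * p.2)
        ((gaussianReal 0 1).prod (gaussianProduct (Measure.dirac 1) n))) := by fun_prop
    rw [gaussianProduct, Measure.mconv]
    constructor
    · rw [integrable_map_measure ha hm.aemeasurable]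
      simpa only [Function.comp_def, abs_mul] using integral_abs_gaussianReal.1.mul_prod ih.1
    · rw [integral_map hm.aemeasurable ha]
      simp only [abs_mul]
      rw [integral_prod_mul (fun x : ℝ => |x|) (fun x : ℝ => |x|), ih.2,
        integral_abs_gaussianReal.2, pow_succ']

/-! ### Laws of products and ratios, and change of variables -/

section Laws

variable {Ω : Type*} [MeasurableSpace Ω] {P : Measure Ω}

theorem hasLaw_prod_gaussianProduct [IsProbabilityMeasure P] {M : ℕ} {X : Fin M → Ω → ℝ}
    (hX : ∀ i, HasLaw (X i) (gaussianReal 0 1) P) (hindep : iIndepFun X P) :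
    HasLaw (fun ω => ∏ i, X i ω) (gaussianProduct (Measure.dirac 1) M) P := by
  induction M with
  | zero =>
    refine ⟨by simp, ?_⟩
    simp [gaussianProduct, Measure.map_const]
  | succ M ih =>
    have h1 := ih (fun i => hX i.succ) (hindep.precomp (Fin.succ_injective M))
    have h2 := hindep.indepFun_finsetProd_of_notMem₀ (fun i => (hX i).aemeasurable)
      (s := Finset.univ.map (Fin.succEmb M)) (i := 0) (by simp)
    have h3 : (∏ j ∈ Finset.univ.map (Fin.succEmb M), X j) = fun ω => ∏ i : Fin M, X i.succ ω := by
      funext ω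
      simp
    rw [h3] at h2
    simp_rw [Fin.prod_univ_succ]
    exact h2.symm.hasLaw_fun_mul (hX 0) h1

theorem indepFun_prod_prod {M N : ℕ} {X : Fin M → Ω → ℝ} {Y : Fin N → Ω → ℝ}
    (hX : ∀ i, AEMeasurable (X i) P) (hY : ∀ j, AEMeasurable (Y j) P)
    (hindep : iIndepFun (Sum.elim X Y) P) :
    IndepFun (fun ω => ∏ i, X i ω) (fun ω => ∏ j, Y j ω) P := by
  have h1 := hindep.indepFun_finset₀ (Finset.univ.map Function.Embedding.inl)
    (Finset.univ.map Function.Embedding.inr)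
    (Finset.disjoint_left.2 (by simp)) (by rintro (i | j); exacts [hX i, hY j])
  have hm : ∀ S : Finset (Fin M ⊕ Fin N), Measurable fun x : S → ℝ => ∏ i, x i :=
    fun S => by fun_prop
  have h2 := h1.comp (hm _) (hm _)
  convert! h2 using 1
  · funext ω
    simp only [Function.comp]
    rw [Finset.prod_coe_sort _ fun i => Sum.elim X Y i ω]
    simp
  · funext ω
    simp only [Function.comp]
    rw [Finset.prod_coe_sort _ fun i => Sum.elim X Y i ω]
    simp

theorem hasLaw_productRatio [IsProbabilityMeasure P] {M N : ℕ} {X : Fin M → Ω → ℝ}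
    {Y : Fin N → Ω → ℝ}
    (hX : ∀ i, HasLaw (X i) (gaussianReal 0 1) P) (hY : ∀ j, HasLaw (Y j) (gaussianReal 0 1) P)
    (hindep : iIndepFun (Sum.elim X Y) P) :
    HasLaw (productRatio X Y)
      (gaussianProduct ((gaussianProduct (Measure.dirac 1) N).map (·⁻¹)) M) P := by
  have h1 := hasLaw_prod_gaussianProduct hX (hindep.precomp (g := Sum.inl) Sum.inl_injective)
  have h2 := hasLaw_prod_gaussianProduct hY (hindep.precomp (g := Sum.inr) Sum.inr_injective)
  have h3 := indepFun_prod_prod (fun i => (hX i).aemeasurable) (fun j => (hY j).aemeasurable)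
    hindep
  have h4 : HasLaw (fun ω => (∏ j, Y j ω)⁻¹)
      ((gaussianProduct (Measure.dirac 1) N).map (·⁻¹)) P :=
    HasLaw.comp (Y := fun x : ℝ => x⁻¹) ⟨by fun_prop, rfl⟩ h2
  have : IsProbabilityMeasure ((gaussianProduct (Measure.dirac 1) N).map (·⁻¹)) :=
    Measure.isProbabilityMeasure_map (by fun_prop)
  have h5 := (h3.comp measurable_id measurable_inv).hasLaw_fun_mul h1 h4
  rw [gaussianProduct_dirac_one_mconv] at h5
  exact h5

theorem IsEvenDensity.isPDFContinuousOffZero {f : ℝ → ℝ} {μ : Measure ℝ} (h : IsEvenDensity f μ)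
    {Z : Ω → ℝ} (hZ : HasLaw Z μ P) : IsPDFContinuousOffZero f Z P :=
  ⟨h.nonneg, h.continuousOn, h.eq_withDensity ▸ hZ⟩

/-- Densities agree almost everywhere, and Lebesgue measure charges every nonempty open set.
Asymptotics of one constructed density thus pass to every admissible one. -/
theorem IsPDFContinuousOffZero.eqOn {f g : ℝ → ℝ} {Z : Ω → ℝ}
    (hf : IsPDFContinuousOffZero f Z P) (hg : IsPDFContinuousOffZero g Z P) :
    Set.EqOn f g {0}ᶜ := by
  have h1 := hf.hasLaw.map_eq.symm.trans hg.hasLaw.map_eq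
  rw [withDensity_eq_iff_of_sigmaFinite
    (measurable_of_continuousOn_compl_zero hf.continuousOn).ennreal_ofReal.aemeasurable
    (measurable_of_continuousOn_compl_zero hg.continuousOn).ennreal_ofReal.aemeasurable] at h1
  refine Measure.eqOn_open_of_ae_eq (μ := volume) (ae_restrict_of_ae (h1.mono fun z hz => ?_))
    isOpen_compl_singleton hf.continuousOn hg.continuousOn
  exact (ENNReal.ofReal_eq_ofReal_iff (hf.nonneg z) (hg.nonneg z)).1 hz

/-- Change of variables for a bijection whose inverse `S` fixes 0 and is differentiable elsewhere;
this covers both scaling and, since `0⁻¹ = 0`, inversion. The origin is a null set and is removed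
before integrating. -/
theorem IsPDFContinuousOffZero.comp {f : ℝ → ℝ} {Z : Ω → ℝ} (h : IsPDFContinuousOffZero f Z P)
    {T S S' : ℝ → ℝ} (hT : Measurable T) (hTS : ∀ z, T (S z) = z) (hST : ∀ z, S (T z) = z)
    (hS0 : S 0 = 0) (hS : ∀ z ≠ 0, HasDerivAt S (S' z) z) (hS' : ContinuousOn S' {0}ᶜ) :
    IsPDFContinuousOffZero (fun z => |S' z| * f (S z)) (fun ω => T (Z ω)) P where
  nonneg z := mul_nonneg (abs_nonneg _) (h.nonneg _)
  continuousOn := by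
    refine hS'.abs.mul (h.continuousOn.comp
      (fun z hz => (hS z hz).continuousAt.continuousWithinAt) fun z hz hSz => hz ?_)
    have hSz' : S z = 0 := hSz
    rw [Set.mem_singleton_iff, ← hTS z, hSz']
    simpa [hS0] using hTS 0
  hasLaw := by
    refine HasLaw.comp (Y := T) ⟨hT.aemeasurable, ?_⟩ h.hasLaw
    ext A hA
    have hA' : MeasurableSet (A \ {0}) := hA.diff (measurableSet_singleton 0)
    have himage : S '' (A \ {0}) = T ⁻¹' A \ {0} := by
      ext z
      constructor
      · rintro ⟨x, ⟨hxA, hx0⟩, rfl⟩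
        refine ⟨by simpa [hTS] using hxA, fun hx => hx0 ?_⟩
        have hx' : S x = 0 := hx
        rw [Set.mem_singleton_iff, ← hTS x, hx']
        simpa [hS0] using hTS 0
      · rintro ⟨hzA, hz0⟩
        refine ⟨T z, ⟨hzA, fun hz => hz0 ?_⟩, hST z⟩
        have hz' : T z = 0 := hz
        rw [Set.mem_singleton_iff, ← hST z, hz', hS0]
    have hnull : ∀ B : Set ℝ, (B \ {0} : Set ℝ) =ᵐ[volume] B := fun B =>
      sdiff_null_ae_eq_self (by simp)
    rw [Measure.map_apply hT hA, withDensity_apply _ (hT hA), withDensity_apply _ hA,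
      ← setLIntegral_congr (hnull (T ⁻¹' A)), ← himage,
      lintegral_image_eq_lintegral_abs_deriv_mul hA'
        (fun z hz => (hS z hz.2).hasDerivWithinAt)
        (fun x _ y _ hxy => by rw [← hTS x, hxy, hTS]), setLIntegral_congr (hnull A)]
    simp_rw [ENNReal.ofReal_mul (abs_nonneg _)]

theorem hasLaw_inv_mul_gaussianReal {X : Ω → ℝ} {σ : ℝ} (hσ : 0 < σ)
    (hX : HasLaw X (gaussianReal 0 (σ ^ 2).toNNReal) P) :
    HasLaw (fun ω => σ⁻¹ * X ω) (gaussianReal 0 1) P := by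
  convert! gaussianReal_const_mul hX σ⁻¹ using 2
  · simp
  · ext
    simp [Real.coe_toNNReal _ (sq_nonneg σ), hσ.ne']

end Laws

/-! ### Reduction to unit variances -/

theorem productRatio_eq_mul {Ω : Type*} {M N : ℕ} (X : Fin M → Ω → ℝ) (Y : Fin N → Ω → ℝ)
    {σ : Fin M → ℝ} {s : Fin N → ℝ} (hσ : ∀ i, 0 < σ i) (hs : ∀ j, 0 < s j) (ω : Ω) :
    productRatio X Y ω = (∏ i, σ i) / (∏ j, s j) *
      productRatio (fun i ω => (σ i)⁻¹ * X i ω) (fun j ω => (s j)⁻¹ * Y j ω) ω := by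
  have h1 : ∏ i, σ i ≠ 0 := Finset.prod_ne_zero_iff.2 fun i _ => (hσ i).ne'
  have h2 : ∏ j, s j ≠ 0 := Finset.prod_ne_zero_iff.2 fun j _ => (hs j).ne'
  simp only [productRatio, Finset.prod_mul_distrib, Finset.prod_inv_distrib]
  rw [div_mul_div_comm, mul_inv_cancel_left₀ h1, mul_inv_cancel_left₀ h2]

theorem iIndepFun_sumElim_mul {Ω : Type*} [MeasurableSpace Ω] {P : Measure Ω} {M N : ℕ}
    {X : Fin M → Ω → ℝ} {Y : Fin N → Ω → ℝ}
    (hindep : iIndepFun (Sum.elim X Y) P) (a : Fin M → ℝ) (b : Fin N → ℝ) :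
    iIndepFun (Sum.elim (fun i ω => a i * X i ω) (fun j ω => b j * Y j ω)) P := by
  have h := hindep.comp (fun i x => Sum.elim a b i * x) (fun i => by fun_prop)
  convert! h using 1
  funext i
  rcases i with i | j <;> rfl

theorem map_inv_singleton_zero {μ : Measure ℝ} (h : μ {0} = 0) : μ.map (·⁻¹) {0} = 0 := by
  rw [Measure.map_apply (by fun_prop) (measurableSet_singleton 0)]
  convert! h using 2
  ext x
  simp

theorem integral_abs_inv_map_inv_gaussianProduct (N : ℕ) :
    Integrable (fun w => |w|⁻¹) ((gaussianProduct (Measure.dirac 1) N).map (·⁻¹)) ∧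
      ∫ w, |w|⁻¹ ∂((gaussianProduct (Measure.dirac 1) N).map (·⁻¹)) = (2 * stdPDF 0) ^ N := by
  have hm : AEMeasurable (fun x : ℝ => x⁻¹) (gaussianProduct (Measure.dirac 1) N) := by fun_prop
  have ha : AEStronglyMeasurable (fun w : ℝ => |w|⁻¹)
      ((gaussianProduct (Measure.dirac 1) N).map (·⁻¹)) :=
    Measurable.aestronglyMeasurable (by fun_prop)
  rw [integrable_map_measure ha hm, integral_map hm ha]
  simpa [Function.comp_def, abs_inv] using integral_abs_gaussianProduct N

/-! ### Constants and the passage to asymptotic equivalence -/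

theorem two_mul_stdPDF_zero : 2 * stdPDF 0 = (2 / Real.pi) ^ (1 / 2 : ℝ) := by
  rw [stdPDF_zero, ← Real.sqrt_eq_rpow, Real.sqrt_div (by norm_num), Real.sqrt_mul (by norm_num)]
  have : √(2 : ℝ) ^ 2 = 2 := Real.sq_sqrt (by norm_num)
  have : √Real.pi ≠ 0 := (Real.sqrt_pos.2 Real.pi_pos).ne'
  field_simp
  linarith

theorem stdPDF_zero_mul_pow (n N : ℕ) :
    stdPDF 0 * (2 * stdPDF 0) ^ N * (2 * stdPDF 0) ^ n =
      (2 : ℝ) ^ ((((n + 1 : ℕ) : ℝ) + N - 2) / 2) /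
        Real.pi ^ ((((n + 1 : ℕ) : ℝ) + N) / 2) := by
  have h1 : stdPDF 0 * (2 * stdPDF 0) ^ N * (2 * stdPDF 0) ^ n =
      (2 * stdPDF 0) ^ (n + 1 + N) / 2 := by ring
  rw [h1, two_mul_stdPDF_zero, ← Real.rpow_mul_natCast (by positivity),
    Real.div_rpow (by norm_num) Real.pi_pos.le, sub_div, div_self (two_ne_zero),
    Real.rpow_sub_one two_ne_zero]
  push_cast
  rw [show 1 / 2 * ((n : ℝ) + 1 + N) = (n + 1 + N) / 2 by ring]
  ring

/-- Used with `b = log c`: rescaling `z` merely shifts `-log |z|`, which is invisible at leading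
order. -/
theorem tendsto_div_pow_add_const {F : ℝ → ℝ} {n : ℕ} {A : ℝ}
    (hF : Tendsto (fun L => F L / L ^ n) atTop (𝓝 A)) (b : ℝ) :
    Tendsto (fun L => F (L + b) / L ^ n) atTop (𝓝 A) := by
  have h1 : Tendsto (fun L : ℝ => L + b) atTop atTop := tendsto_atTop_add_const_right _ b tendsto_id
  have h2 : Tendsto (fun L : ℝ => (1 + b / L) ^ n) atTop (𝓝 1) := by
    have : Tendsto (fun L : ℝ => 1 + b / L) atTop (𝓝 (1 + 0)) :=
      tendsto_const_nhds.add (tendsto_const_nhds.div_atTop tendsto_id)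
    simpa using this.pow n
  have h3 := (hF.comp h1).mul h2
  rw [mul_one] at h3
  refine h3.congr' ?_
  filter_upwards [eventually_gt_atTop 0, eventually_gt_atTop (-b)] with L hL hLb
  have h4 : 1 + b / L = (L + b) / L := by field_simp
  have h5 : 0 < L + b := by linarith
  simp only [Function.comp]
  rw [h4, div_pow]
  field_simp

theorem tendsto_neg_log_abs : Tendsto (fun z : ℝ => -Real.log |z|) (𝓝[≠] 0) atTop := by
  simp_rw [Real.log_abs]
  exact tendsto_neg_atBot_atTop.comp Real.tendsto_log_nhdsNE_zero

theorem isEquivalent_log_of_tendsto {F : ℝ → ℝ} (hF : ∀ z, F |z| = F z) {n : ℕ} {A B c : ℝ}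
    (hlim : Tendsto (fun L => F (Real.exp (-L)) / L ^ n) atTop (𝓝 A)) (hc : 0 < c)
    (hB : c⁻¹ * A = B / n !) (hB0 : B ≠ 0) :
    (fun z => |c⁻¹| * F (c⁻¹ * z)) ~[𝓝[≠] 0] fun z => B * ((-Real.log |z|) ^ n / n !) := by
  apply isEquivalent_of_tendsto_one
  have hn : (n ! : ℝ) ≠ 0 := by positivity
  have h1 := ((tendsto_div_pow_add_const (F := fun L => F (Real.exp (-L))) hlim
    (Real.log c)).comp tendsto_neg_log_abs).const_mul (c⁻¹ * (B / n !)⁻¹)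
  have h2 : c⁻¹ * (B / n !)⁻¹ * A = 1 := by
    rw [mul_right_comm, hB, mul_inv_cancel₀ (div_ne_zero hB0 hn)]
  rw [h2] at h1
  refine h1.congr' ?_
  filter_upwards [self_mem_nhdsWithin] with z hz
  have hz0 : 0 < |z| := abs_pos.2 hz
  have h3 : Real.exp (-(-Real.log |z| + Real.log c)) = |c⁻¹ * z| := by
    rw [neg_add, neg_neg, Real.exp_add, Real.exp_log hz0, Real.exp_neg, Real.exp_log hc, abs_mul,
      abs_of_pos (inv_pos.2 hc), mul_comm]
  simp only [Function.comp, Pi.div_apply]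
  rw [h3, hF, abs_of_pos (inv_pos.2 hc)]
  field_simp

theorem sqrt_two_pow_div (n : ℕ) :
    √2 ^ n * (√(2 * Real.pi))⁻¹ / √(n + 1) =
      (2 : ℝ) ^ ((((n + 1 : ℕ) : ℝ) - 2) / 2) / √(((n + 1 : ℕ) : ℝ) * Real.pi) := by
  have h1 : (2 : ℝ) ^ ((((n + 1 : ℕ) : ℝ) - 2) / 2) = √2 ^ n / √2 := by
    rw [Real.sqrt_eq_rpow, ← Real.rpow_mul_natCast (by norm_num), ← Real.rpow_sub (by norm_num)]
    congr 1
    push_cast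
    ring
  rw [h1, Real.sqrt_mul (by norm_num), Real.sqrt_mul (by positivity)]
  push_cast
  field_simp

theorem isEquivalent_exp_of_tendsto {F : ℝ → ℝ} (hF : ∀ z, F |z| = F z) {n : ℕ} {K s : ℝ}
    (hlim : Tendsto (tailRatio F n) atTop (𝓝 K)) (hK : K ≠ 0) (hs : 0 < s) :
    (fun z => |-s⁻¹ / z ^ 2| * F (s⁻¹ * z⁻¹)) ~[𝓝[≠] 0] fun z =>
      K / s ^ (1 / ((n + 1 : ℕ) : ℝ)) *
        |z| ^ (-(((n + 1 : ℕ) : ℝ) + 1) / ((n + 1 : ℕ) : ℝ)) *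
        Real.exp (-(((n + 1 : ℕ) : ℝ) / (2 * (s * |z|) ^ (2 / ((n + 1 : ℕ) : ℝ))))) := by
  rw [isEquivalent_iff_exists_eq_mul]
  set m : ℝ := ((n + 1 : ℕ) : ℝ) with hm
  have hm0 : 0 < m := by rw [hm]; positivity
  have hr : Tendsto (fun z : ℝ => (s * |z|) ^ (-(1 / m))) (𝓝[≠] 0) atTop := by
    have h1 : Tendsto (fun z : ℝ => s * |z|) (𝓝[≠] 0) (𝓝[>] 0) := by
      refine tendsto_nhdsWithin_iff.2 ⟨?_, ?_⟩
      · have : Continuous fun z : ℝ => s * |z| := by fun_prop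
        simpa using (this.tendsto 0).mono_left nhdsWithin_le_nhds
      · filter_upwards [self_mem_nhdsWithin] with z hz
        exact mul_pos hs (abs_pos.2 hz)
    exact (tendsto_rpow_neg_nhdsGT_zero (neg_neg_of_pos (by positivity))).comp h1
  -- With `y = (s |z|)^(-1/m)`, the power `y ^ (n + 1)` is `1 / (s |z|)`, and the quotient of the
  -- two sides is exactly `tailRatio F n y / K`.
  refine ⟨fun z => tailRatio F n ((s * |z|) ^ (-(1 / m))) / K, ?_, ?_⟩
  · simpa [hK] using (hlim.comp hr).div_const K
  · filter_upwards [self_mem_nhdsWithin] with z hz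
    have hz0 : 0 < |z| := abs_pos.2 hz
    set t := s * |z| with ht
    have ht0 : 0 < t := by positivity
    have e1 : (t ^ (-(1 / m))) ^ (n + 1) = t⁻¹ := by
      rw [← Real.rpow_mul_natCast ht0.le, ← hm, neg_mul, one_div_mul_cancel hm0.ne',
        Real.rpow_neg_one]
    have e2 : F (s⁻¹ * z⁻¹) = F t⁻¹ := by
      rw [← hF, abs_mul, abs_of_pos (inv_pos.2 hs), abs_inv, ht, mul_inv]
    have e3 : (t ^ (-(1 / m))) ^ n = t⁻¹ * t ^ (1 / m) := by
      rw [← e1, pow_succ, mul_assoc, ← Real.rpow_add ht0, neg_add_cancel, Real.rpow_zero, mul_one]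
    have e4 : m / (2 * t ^ (2 / m)) = (n + 1) * (t ^ (-(1 / m))) ^ 2 / 2 := by
      rw [← Real.rpow_mul_natCast ht0.le, hm]
      push_cast
      rw [show -(1 / ((n : ℝ) + 1)) * 2 = -(2 / (n + 1)) by ring, Real.rpow_neg ht0.le]
      field_simp
    have e5 : |z| ^ (-(m + 1) / m) = |z|⁻¹ * (|z| ^ (1 / m))⁻¹ := by
      rw [← Real.rpow_neg hz0.le, ← Real.rpow_neg_one, ← Real.rpow_add hz0]
      congr 1
      field_simp
      ring
    have e6 : t ^ (1 / m) = s ^ (1 / m) * |z| ^ (1 / m) := Real.mul_rpow hs.le hz0.le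
    have e7 : |-s⁻¹ / z ^ 2| = s⁻¹ / |z| ^ 2 := by
      rw [abs_div, abs_neg, abs_of_pos (inv_pos.2 hs), abs_pow]
    have h1 : 0 < s ^ (1 / m) := by positivity
    have h2 : 0 < |z| ^ (1 / m) := by positivity
    simp only [Pi.mul_apply, tailRatio]
    rw [e1, e2, e3, e4, e5, e6, e7, Real.exp_neg, ht]
    have h3 := (Real.exp_pos ((n + 1) * ((s * |z|) ^ (-(1 / m))) ^ 2 / 2)).ne'
    field_simp

theorem theorem2p4 {Ω : Type*} [MeasurableSpace Ω] (P : Measure Ω) [IsProbabilityMeasure P]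
    (M N : ℕ) (hMN : 1 ≤ M + N)
    (X : Fin M → Ω → ℝ) (Y : Fin N → Ω → ℝ) (σ : Fin M → ℝ) (s : Fin N → ℝ)
    (hσ : ∀ i, 0 < σ i) (hs : ∀ j, 0 < s j)
    (hX : ∀ i, HasLaw (X i) (gaussianReal 0 (σ i ^ 2).toNNReal) P)
    (hY : ∀ j, HasLaw (Y j) (gaussianReal 0 (s j ^ 2).toNNReal) P)
    (hindep : iIndepFun (Sum.elim X Y) P) :
    (∃ f : ℝ → ℝ, IsPDFContinuousOffZero f (productRatio X Y) P) ∧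
    ∀ f : ℝ → ℝ, IsPDFContinuousOffZero f (productRatio X Y) P →
      (1 ≤ M →
        f ~[𝓝[≠] 0] fun z : ℝ =>
          (2 : ℝ) ^ (((M : ℝ) + (N : ℝ) - 2) / 2) * (∏ j, s j) /
              (Real.pi ^ (((M : ℝ) + (N : ℝ)) / 2) * ∏ i, σ i) *
            ((-Real.log |z|) ^ (M - 1) / ((M - 1)! : ℝ))) ∧
      (M = 0 → 1 ≤ N →
        f ~[𝓝[≠] 0] fun z : ℝ =>
          (2 : ℝ) ^ (((N : ℝ) - 2) / 2) /
              (√((N : ℝ) * Real.pi) * (∏ j, s j) ^ (1 / (N : ℝ))) *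
            |z| ^ (-((N : ℝ) + 1) / (N : ℝ)) *
            Real.exp (-((N : ℝ) / (2 * ((∏ j, s j) * |z|) ^ (2 / (N : ℝ)))))) := by
  have hX' := fun i => hasLaw_inv_mul_gaussianReal (hσ i) (hX i)
  have hY' := fun j => hasLaw_inv_mul_gaussianReal (hs j) (hY j)
  have hindep' := iIndepFun_sumElim_mul hindep (fun i => (σ i)⁻¹) (fun j => (s j)⁻¹)
  have hσ0 : 0 < ∏ i, σ i := Finset.prod_pos fun i _ => hσ i
  have hs0 : 0 < ∏ j, s j := Finset.prod_pos fun j _ => hs j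
  have hcongr : ∀ {f g : ℝ → ℝ}, IsPDFContinuousOffZero f (productRatio X Y) P →
      IsPDFContinuousOffZero g (productRatio X Y) P → g =ᶠ[𝓝[≠] 0] f := by
    intro f g hf hg
    filter_upwards [self_mem_nhdsWithin] with z hz
    exact hg.eqOn hf hz
  rcases M with _ | n
  · obtain ⟨k, rfl⟩ : ∃ k, N = k + 1 := ⟨N - 1, by omega⟩
    have hev := isEvenDensity_gaussianProduct dirac_one_singleton_zero k
    -- Inversion with this scale is an involution of the whole line, so it serves as both `T` and
    -- `S`.
    have hinv : ∀ z : ℝ, (∏ j, s j)⁻¹ * ((∏ j, s j)⁻¹ * z⁻¹)⁻¹ = z := fun z => by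
      rw [mul_inv, inv_inv, inv_inv, inv_mul_cancel_left₀ hs0.ne']
    have hpdf := (hev.isPDFContinuousOffZero (hasLaw_prod_gaussianProduct hY'
      (hindep'.precomp (g := Sum.inr) Sum.inr_injective))).comp
      (T := fun z => (∏ j, s j)⁻¹ * z⁻¹) (S := fun z => (∏ j, s j)⁻¹ * z⁻¹)
      (S' := fun z => -(∏ j, s j)⁻¹ / z ^ 2) (by fun_prop)
      hinv hinv (by simp)
      (fun z hz => by
        convert! (hasDerivAt_inv hz).const_mul (∏ j, s j)⁻¹ using 1
        ring)
      (continuousOn_const.div (by fun_prop) fun z hz => pow_ne_zero 2 hz)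
    have hZ : (fun ω => (∏ j, s j)⁻¹ * (∏ j, (s j)⁻¹ * Y j ω)⁻¹) = productRatio X Y := by
      funext ω
      rw [productRatio_eq_mul X Y hσ hs]
      simp [productRatio]
    rw [hZ] at hpdf
    refine ⟨⟨_, hpdf⟩, fun f hf => ⟨fun h => absurd h (by norm_num), fun _ _ => ?_⟩⟩
    have h1 := isEquivalent_exp_of_tendsto hev.apply_abs (tendsto_tailRatio_gaussianProduct k)
      (by positivity) hs0
    rw [sqrt_two_pow_div] at h1
    simp only [div_div] at h1 ⊢
    exact h1.congr_left (hcongr hf hpdf)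
  -- The reciprocal of the denominator is the starting law, to which the `n + 1` numerator factors
  -- are applied.
  · set ν := (gaussianProduct (Measure.dirac 1) N).map (·⁻¹) with hν
    have : IsProbabilityMeasure ν := Measure.isProbabilityMeasure_map (by fun_prop)
    have hν0 : ν {0} = 0 := map_inv_singleton_zero
      (gaussianProduct_singleton_zero dirac_one_singleton_zero N)
    have hev := isEvenDensity_gaussianProduct hν0 n
    have hc : 0 < (∏ i, σ i) / ∏ j, s j := div_pos hσ0 hs0
    set c := (∏ i, σ i) / ∏ j, s j with hcdef
    have hinv : ∀ z : ℝ, (∏ j, s j)⁻¹ * ((∏ j, s j)⁻¹ * z⁻¹)⁻¹ = z := fun z => by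
      rw [mul_inv, inv_inv, inv_inv, inv_mul_cancel_left₀ hs0.ne']
    have hpdf := (hev.isPDFContinuousOffZero (hasLaw_productRatio hX' hY' hindep')).comp
      (T := fun z => c * z) (S := fun z => c⁻¹ * z) (S' := fun _ => c⁻¹) (by fun_prop)
      (fun z => mul_inv_cancel_left₀ hc.ne' z) (fun z => inv_mul_cancel_left₀ hc.ne' z) (by simp)
      (fun z _ => by simpa using (hasDerivAt_id z).const_mul c⁻¹) continuousOn_const
    have hZ : (fun ω => c * productRatio (fun i ω => (σ i)⁻¹ * X i ω)
        (fun j ω => (s j)⁻¹ * Y j ω) ω) = productRatio X Y :=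
      funext fun ω => (productRatio_eq_mul X Y hσ hs ω).symm
    rw [hZ] at hpdf
    refine ⟨⟨_, hpdf⟩, fun f hf => ⟨fun _ => ?_, fun h => absurd h (by simp)⟩⟩
    obtain ⟨hint, hval⟩ := integral_abs_inv_map_inv_gaussianProduct N
    have h1 := tendsto_productDensity_gaussianProduct_log hν0 hint n
    rw [hval, stdPDF_zero_mul_pow] at h1
    refine (isEquivalent_log_of_tendsto hev.apply_abs h1 hc ?_ ?_).congr_left (hcongr hf hpdf)
    · rw [hcdef, inv_div]
      field_simp
    · positivity
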